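/- **Proposition 4.2.** For $n\ge 0$ let $B_n^+$ be the monoid generated by $\sigma_1,\dots,\sigma_{n-1}$ with the relations $\sigma_i\sigma_j=\sigma_j\sigma_i$ for $|i-j|\ge 2$ and $\sigma_i\sigma_j\sigma_i=\sigma_j\sigma_i\sigma_j$ for $|i-j|=1$ (so $B_0^+$ and $B_1^+$ are trivial). Let $\Delta_0=\Delta_1=1$ and $\Delta_n=\sigma_1\sigma_2\cdots\sigma_{n-1}\Delta_{n-1}$ for $n\ge 2$, and let $b_{n,2}$ be the number of left divisors of $\Delta_n^2$ in $B_n^+$, that is, of $x\in B_n^+$ such that $\Delta_n^2=xz$ for some $z\in B_n^+$. Then: 1. The numbers $b_{n,2}$ are determined by the induction $$b_{0,2}=1,\qquad b_{n,2}=\sum_{i=0}^{n-1}(-1)^{n+i+1}\binom{n}{i}^2 b_{i,2}\quad(n\ge 1),$$ that is, they satisfy it, and every integer sequence satisfying it is equal to $(b_{n,2})_{n\ge 0}$. 2. Their double exponential generating function is $$\sum_{n=0}^{\infty} b_{n,2}\,\frac{x^n}{n!^2}=\Bigl(\sum_{n=0}^{\infty}(-1)^n\frac{x^n}{n!^2}\Bigr)^{-1}=\frac{1}{J_0(2\sqrt{x})},$$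 where $J_0(z)=\sum_{m\ge 0}\frac{(-1)^m}{m!^2}\bigl(\frac z2\bigr)^{2m}$ is the Bessel function of the first kind of order $0$. The first equality holds in $\mathbb{Q}[[x]]$. Moreover, for every complex $x$ with $|x|<1$ and each choice of the square root, $J_0(2\sqrt x)\ne 0$ and the series on the left converges to $1/J_0(2\sqrt x)$. 3. For every $n\ge 0$, $b_{n,2}$ is the number of pairs $(f,g)$ of permutations of $\{1,\dots,n\}$ with no common descent, that is, such that there is no $i$ with $1\le i<n$, $f(i)>f(i+1)$ and $g(i)>g(i+1)$. -/

import Mathlib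

open scoped Nat

namespace PositiveBraid

/-- The defining relations of Artin's presentation on `n` strands. The generator `σ_{k+1}` is
represented by the letter `k : Fin (n - 1)`. Since the congruence generated by the relations is
symmetric, it is enough to list each relation for `i < j`. -/
inductive Rel (n : ℕ) : FreeMonoid (Fin (n - 1)) → FreeMonoid (Fin (n - 1)) → Prop
  | comm (i j : Fin (n - 1)) (h : i.val + 2 ≤ j.val) :
      Rel n (FreeMonoid.of i * FreeMonoid.of j) (FreeMonoid.of j * FreeMonoid.of i)
  | braid (i j : Fin (n - 1)) (h : i.val + 1 = j.val) :
      Rel n (FreeMonoid.of i * FreeMonoid.of j * FreeMonoid.of i)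
        (FreeMonoid.of j * FreeMonoid.of i * FreeMonoid.of j)

/-- The monoid `B_n^+` of positive `n`-strand braids. For `n = 0` and `n = 1` it is trivial. -/
abbrev BraidMonoid (n : ℕ) : Type := PresentedMonoid (Rel n)

/-- The Artin generators; `σ n k` is `σ_{k+1}` in the usual numbering from `1`. -/
def σ (n : ℕ) (k : Fin (n - 1)) : BraidMonoid n := PresentedMonoid.of (Rel n) k

/-- The word `σ_1 σ_2 ⋯ σ_{n-1} · (word of Δ_{n-1})`, with letters numbered from `0`. -/
def deltaWord : (n : ℕ) → List (Fin (n - 1))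
  | 0 => []
  | 1 => []
  | n + 2 => List.finRange (n + 1) ++ (deltaWord (n + 1)).map (Fin.castSucc : Fin n → Fin (n + 1))

/-- Garside's fundamental braid `Δ_n`: `Δ_1 = 1` and `Δ_n = σ_1 σ_2 ⋯ σ_{n-1} Δ_{n-1}`. -/
def Δ (n : ℕ) : BraidMonoid n := ((deltaWord n).map (σ n)).prod

/-- `b n d` is the number of left divisors of `Δ_n ^ d` in the monoid `B_n^+`. In a
(noncommutative) monoid, Mathlib's `x ∣ y` means `∃ z, y = x * z`, that is, left divisibility. -/
noncomputable def b (n d : ℕ) : ℕ := {x : BraidMonoid n | x ∣ Δ n ^ d}.ncard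

/-- `i` (numbered from `0`) is a descent of the permutation `f`: `f (i) > f (i + 1)`. -/
def IsDescent {n : ℕ} (f : Equiv.Perm (Fin n)) (i : ℕ) : Prop :=
  ∃ h : i + 1 < n, f ⟨i + 1, h⟩ < f ⟨i, Nat.lt_of_succ_lt h⟩

/-- The Bessel function of the first kind of order zero,
`J_0(z) = ∑ (-1)^m / (m!)^2 * (z/2)^(2m)` (the series converges for every complex `z`). -/
noncomputable def besselJ0 (z : ℂ) : ℂ :=
  ∑' m : ℕ, (-1 : ℂ) ^ m / ((m ! : ℂ) ^ 2) * (z / 2) ^ (2 * m)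

end PositiveBraid

/-! The proof rests on a normal form for the divisors of `Δ n ^ 2`. A braid is simple when its
length is the inversion number of its permutation; simple braids correspond bijectively to
permutations (`exists_simple_lift`, `Simple.eq_of_perm_eq`) and are the left divisors of `Δ n`.
Garside's key lemma `headRel_of_eq` gives left cancellation and conditional right lcms. Together
with the centrality of `Δ n ^ 2`, these identify its divisors with the products of two simple braids
(`dvd_Δ_sq_iff`). Such a product has a unique greedy form `a * b`, in which every left descent of
`b` is a right descent of `a`. The reversal complements descents, so greedy forms become pairs of
permutations without common descent (`b_two_eq_ncard`).

Counting these pairs is an inclusion-exclusion. The number `(n.choose i) ^ 2 * b i 2` counts pairs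
that decrease together from position `i` on and have no common descent inside the first `i`
positions. The junction between the two blocks is unconstrained; splitting by what happens there
makes the alternating sum telescope to zero, which is the recursion. Divided by `n ! ^ 2`, it says
that the two generating series have Cauchy product 1, formally and, because `b n 2 ≤ n ! ^ 2`, on
the open unit disc. -/

namespace PositiveBraid

/-! ### The positive braid monoid: generators, word length, Garside's key lemma -/

section Garside

variable {n : ℕ}

/-- Two generators are adjacent if their indices differ by one. -/
def Adj (i j : Fin (n - 1)) : Prop := i.val + 1 = j.val ∨ j.val + 1 = i.val

/-- Two generators are far apart if their indices differ by at least two. -/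
def Far (i j : Fin (n - 1)) : Prop := i.val + 2 ≤ j.val ∨ j.val + 2 ≤ i.val

lemma Adj.symm {i j : Fin (n - 1)} (h : Adj i j) : Adj j i := Or.symm h

lemma Far.symm {i j : Fin (n - 1)} (h : Far i j) : Far j i := Or.symm h

lemma eq_or_far_or_adj (i j : Fin (n - 1)) : i = j ∨ Far i j ∨ Adj i j := by
  unfold Far Adj; rw [Fin.ext_iff]; omega

lemma σ_comm {i j : Fin (n - 1)} (h : Far i j) : σ n i * σ n j = σ n j * σ n i := by
  rcases h with h | h
  · exact PresentedMonoid.mk_eq_mk_of_rel (Rel.comm i j h)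
  · exact (PresentedMonoid.mk_eq_mk_of_rel (Rel.comm j i h)).symm

lemma σ_braid {i j : Fin (n - 1)} (h : Adj i j) :
    σ n i * σ n j * σ n i = σ n j * σ n i * σ n j := by
  rcases h with h | h
  · exact PresentedMonoid.mk_eq_mk_of_rel (Rel.braid i j h)
  · exact (PresentedMonoid.mk_eq_mk_of_rel (Rel.braid j i h)).symm

lemma σ_comm_mul {i j : Fin (n - 1)} (h : Far i j) (x : BraidMonoid n) :
    σ n i * (σ n j * x) = σ n j * (σ n i * x) := by
  rw [← mul_assoc, σ_comm h, mul_assoc]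

lemma σ_braid_mul {i j : Fin (n - 1)} (h : Adj i j) (x : BraidMonoid n) :
    σ n i * (σ n j * (σ n i * x)) = σ n j * (σ n i * (σ n j * x)) := by
  simpa only [mul_assoc] using congrArg (· * x) (σ_braid h)

lemma mk_of (i : Fin (n - 1)) : PresentedMonoid.mk (Rel n) (FreeMonoid.of i) = σ n i := rfl

@[elab_as_elim]
lemma braid_induction {P : BraidMonoid n → Prop} (x : BraidMonoid n) (one : P 1)
    (mul : ∀ i y, P y → P (σ n i * y)) : P x := by
  induction x using PresentedMonoid.inductionOn with | _ w
  induction w using FreeMonoid.recOn with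
  | one => exact one
  | of_mul i w h => rw [map_mul]; exact mul i _ h

lemma eq_one_or_σ_mul (x : BraidMonoid n) : x = 1 ∨ ∃ i y, x = σ n i * y := by
  induction x using braid_induction with
  | one => exact Or.inl rfl
  | mul i y _ => exact Or.inr ⟨i, y, rfl⟩

/-- The word length, as a monoid homomorphism. -/
def lenHom (n : ℕ) : BraidMonoid n →* Multiplicative ℕ :=
  PresentedMonoid.lift (fun _ => Multiplicative.ofAdd 1) (by
    intro a b h
    cases h <;> simp [mul_comm])

/-- The length of a positive braid. -/
def len (x : BraidMonoid n) : ℕ := (lenHom n x).toAdd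

@[simp] lemma len_one : len (1 : BraidMonoid n) = 0 := by simp [len]

@[simp] lemma len_mul (x y : BraidMonoid n) : len (x * y) = len x + len y := by simp [len]

@[simp] lemma len_σ (i : Fin (n - 1)) : len (σ n i) = 1 := by
  simp [len, lenHom, σ]

lemma len_eq_zero {x : BraidMonoid n} (h : len x = 0) : x = 1 := by
  rcases eq_one_or_σ_mul x with rfl | ⟨i, y, rfl⟩
  · rfl
  · simp at h

/-- The complement: `σ i * compl i j` is the right lcm of `σ i` and `σ j`. -/
def compl (i j : Fin (n - 1)) : BraidMonoid n :=
  if i = j then 1 else if i.val + 1 = j.val ∨ j.val + 1 = i.val then σ n j * σ n i else σ n j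

lemma compl_self (i : Fin (n - 1)) : compl i i = 1 := if_pos rfl

lemma compl_far {i j : Fin (n - 1)} (h : Far i j) : compl i j = σ n j := by
  unfold compl Far at *
  rw [if_neg (by rw [Fin.ext_iff]; omega), if_neg (by omega)]

lemma compl_adj {i j : Fin (n - 1)} (h : Adj i j) : compl i j = σ n j * σ n i := by
  unfold compl Adj at *
  rw [if_neg (by rw [Fin.ext_iff]; omega), if_pos h]

lemma σ_mul_compl (i j : Fin (n - 1)) : σ n i * compl i j = σ n j * compl j i := by
  rcases eq_or_far_or_adj i j with rfl | h | h
  · rfl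
  · rw [compl_far h, compl_far h.symm, σ_comm h]
  · rw [compl_adj h, compl_adj h.symm, ← mul_assoc, ← mul_assoc, σ_braid h]

/-- `σ i * a` and `σ j * b` are equal for the reason that both are the same multiple of the lcm
of `σ i` and `σ j`. -/
def HeadRel (i j : Fin (n - 1)) (a b : BraidMonoid n) : Prop :=
  ∃ c, a = compl i j * c ∧ b = compl j i * c

lemma HeadRel.symm {i j : Fin (n - 1)} {a b : BraidMonoid n} (h : HeadRel i j a b) :
    HeadRel j i b a := by
  obtain ⟨c, h₁, h₂⟩ := h
  exact ⟨c, h₂, h₁⟩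

lemma headRel_self {i : Fin (n - 1)} {a b : BraidMonoid n} : HeadRel i i a b ↔ a = b := by
  simp [HeadRel, compl_self, eq_comm]

lemma headRel_far {i j : Fin (n - 1)} (h : Far i j) {a b : BraidMonoid n} :
    HeadRel i j a b ↔ ∃ c, a = σ n j * c ∧ b = σ n i * c := by
  simp [HeadRel, compl_far h, compl_far h.symm]

lemma headRel_adj {i j : Fin (n - 1)} (h : Adj i j) {a b : BraidMonoid n} :
    HeadRel i j a b ↔ ∃ c, a = σ n j * (σ n i * c) ∧ b = σ n i * (σ n j * c) := by
  simp [HeadRel, compl_adj h, compl_adj h.symm, mul_assoc]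

/-- Garside's key property for left factors of length less than `L`. -/
def KeyBelow (n L : ℕ) : Prop :=
  ∀ (i j : Fin (n - 1)) (a b : BraidMonoid n), len a < L → σ n i * a = σ n j * b → HeadRel i j a b

lemma KeyBelow.cancel {L : ℕ} (H : KeyBelow n L) {i : Fin (n - 1)} {a b : BraidMonoid n}
    (ha : len a < L) (h : σ n i * a = σ n i * b) : a = b :=
  headRel_self.1 (H i i a b ha h)

/-- The mixed case of `HeadRel.trans`. As `d` begins with a letter, each appeal to `H` concerns a
tail shorter than `d`. -/
lemma HeadRel.trans_adj_far {L : ℕ} (H : KeyBelow n L) {i k j : Fin (n - 1)}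
    {a d b : BraidMonoid n} (hd : len d ≤ L) (hki : Adj k i) (hkj : Far k j) (hij : i ≠ j)
    (h₁ : HeadRel i k a d) (h₂ : HeadRel k j d b) : HeadRel i j a b := by
  obtain ⟨c, rfl, rfl⟩ := (headRel_adj hki.symm).1 h₁
  obtain ⟨e, hd', rfl⟩ := (headRel_far hkj).1 h₂
  simp only [len_mul, len_σ] at hd
  rcases eq_or_far_or_adj i j with h | h | h
  · exact absurd h hij
  · obtain ⟨f, hf, rfl⟩ := (headRel_far h).1 (H i j _ _ (by simp; omega) hd')
    obtain ⟨g, rfl, rfl⟩ := (headRel_far hkj).1 (H k j _ _ (by omega) hf)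
    refine (headRel_far h).2 ⟨σ n k * (σ n i * g), ?_, σ_braid_mul hki g⟩
    rw [σ_comm_mul h, σ_comm_mul hkj]
  · obtain ⟨f, hf, rfl⟩ := (headRel_adj h).1 (H i j _ _ (by simp; omega) hd')
    obtain ⟨g, rfl, hg⟩ := (headRel_far hkj).1 (H k j _ _ (by omega) hf)
    have hl := congrArg len hg
    simp only [len_mul, len_σ] at hl hd
    obtain ⟨p, rfl, rfl⟩ := (headRel_adj hki.symm).1 (H i k _ _ (by omega) hg)
    refine (headRel_adj h).2 ⟨σ n k * (σ n i * (σ n j * p)), ?_, ?_⟩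
    · rw [σ_braid_mul h, σ_comm_mul hkj (σ n i * (σ n j * (σ n k * p))), σ_comm_mul hkj.symm p,
        σ_braid_mul hki]
    · rw [σ_comm_mul hkj.symm (σ n i * p), σ_braid_mul hki, σ_braid_mul h, σ_comm_mul hkj]

/-- The cube condition on three generators, checked by the position of `k` relative to `i` and `j`.
It contracts a chain of elementary rewritings to a single common multiple. -/
lemma HeadRel.trans {L : ℕ} (H : KeyBelow n L) {i k j : Fin (n - 1)} {a d b : BraidMonoid n}
    (hd : len d ≤ L) (h₁ : HeadRel i k a d) (h₂ : HeadRel k j d b) : HeadRel i j a b := by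
  rcases eq_or_far_or_adj k i with rfl | hki | hki
  · rwa [headRel_self.1 h₁]
  · rcases eq_or_far_or_adj k j with rfl | hkj | hkj
    · rwa [← headRel_self.1 h₂]
    · obtain ⟨c, rfl, rfl⟩ := (headRel_far hki.symm).1 h₁
      obtain ⟨e, hd', rfl⟩ := (headRel_far hkj).1 h₂
      simp only [len_mul, len_σ] at hd
      have h := H i j c e (by omega) hd'
      rcases eq_or_far_or_adj i j with rfl | hij | hij
      · rw [headRel_self] at *
        rw [h]
      · obtain ⟨f, rfl, rfl⟩ := (headRel_far hij).1 h
        exact (headRel_far hij).2 ⟨σ n k * f, σ_comm_mul hkj f, σ_comm_mul hki f⟩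
      · obtain ⟨f, rfl, rfl⟩ := (headRel_adj hij).1 h
        refine (headRel_adj hij).2 ⟨σ n k * f, ?_, ?_⟩
        · rw [σ_comm_mul hkj, σ_comm_mul hki]
        · rw [σ_comm_mul hki, σ_comm_mul hkj]
    · refine (HeadRel.trans_adj_far H hd hkj hki ?_ h₂.symm h₁.symm).symm
      rintro rfl
      unfold Far Adj at *; omega
  · rcases eq_or_far_or_adj k j with rfl | hkj | hkj
    · rwa [← headRel_self.1 h₂]
    · refine HeadRel.trans_adj_far H hd hki hkj ?_ h₁ h₂
      rintro rfl
      unfold Far Adj at *; omega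
    · obtain ⟨c, rfl, rfl⟩ := (headRel_adj hki.symm).1 h₁
      obtain ⟨e, hd', rfl⟩ := (headRel_adj hkj).1 h₂
      have hl := congrArg len hd'
      simp only [len_mul, len_σ] at hd hl
      have h := H i j _ _ (by simp; omega) hd'
      rcases eq_or_far_or_adj i j with rfl | hij | hij
      · rw [headRel_self] at *
        rw [H.cancel (by omega) h]
      · obtain ⟨f, hf, hf'⟩ := (headRel_far hij).1 h
        obtain ⟨g, rfl, hg⟩ := (headRel_adj hkj).1 (H k j _ _ (by omega) hf)
        obtain ⟨q, rfl, hq⟩ := (headRel_adj hki).1 (H k i _ _ (by omega) hf')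
        have hl' := congrArg len hg
        simp only [len_mul, len_σ] at hd hl hl'
        have hgq := H.cancel (by simp; omega) (hg.symm.trans hq)
        obtain ⟨p, rfl, rfl⟩ := (headRel_far hij.symm).1 (H j i _ _ (by omega) hgq)
        refine (headRel_far hij).2 ⟨σ n k * (σ n j * (σ n i * (σ n k * p))), ?_, ?_⟩
        · rw [σ_comm_mul hij (σ n k * _), σ_braid_mul hki.symm, σ_braid_mul hkj.symm]
        · rw [σ_comm_mul hij.symm (σ n k * p), σ_braid_mul hki.symm, σ_comm_mul hij.symm,
            σ_braid_mul hkj]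
      · exfalso
        unfold Adj at *; omega

lemma headRel_of_rel {w w' : FreeMonoid (Fin (n - 1))} (h : Rel n w w') :
    ∃ i j v v', w = FreeMonoid.of i * v ∧ w' = FreeMonoid.of j * v' ∧
      HeadRel i j (PresentedMonoid.mk (Rel n) v) (PresentedMonoid.mk (Rel n) v') := by
  cases h with
  | comm i j h =>
    refine ⟨i, j, FreeMonoid.of j, FreeMonoid.of i, rfl, rfl, ?_⟩
    exact (headRel_far (Or.inl h)).2 ⟨1, by simp [mk_of], by simp [mk_of]⟩
  | braid i j h =>
    refine ⟨i, j, FreeMonoid.of j * FreeMonoid.of i, FreeMonoid.of i * FreeMonoid.of j,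
      by rw [mul_assoc], by rw [mul_assoc], ?_⟩
    exact (headRel_adj (Or.inl h)).2 ⟨1, by simp [mk_of], by simp [mk_of]⟩

lemma of_mul_injective {α : Type*} {i j : α} {v w : FreeMonoid α}
    (h : FreeMonoid.of i * v = FreeMonoid.of j * w) : i = j ∧ v = w := by
  have h' := congrArg FreeMonoid.toList h
  simpa using h'

/-- Induction on the derivation of the congruence. The clause on empty words supplies a first letter
for the middle word of a transitivity step and settles an empty left factor in a product step. -/
lemma key_of_conGen {L : ℕ} (H : KeyBelow n L) {w w' : FreeMonoid (Fin (n - 1))}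
    (h : ConGen.Rel (Rel n) w w') :
    (w = 1 ↔ w' = 1) ∧ ∀ i j v v', w = FreeMonoid.of i * v → w' = FreeMonoid.of j * v' →
      len (PresentedMonoid.mk (Rel n) v) ≤ L →
      HeadRel i j (PresentedMonoid.mk (Rel n) v) (PresentedMonoid.mk (Rel n) v') := by
  have hne : ∀ (i : Fin (n - 1)) (v : FreeMonoid (Fin (n - 1))), FreeMonoid.of i * v ≠ 1 := by
    intro i v h
    simpa using congrArg FreeMonoid.toList h
  have hcases : ∀ w : FreeMonoid (Fin (n - 1)), w = 1 ∨ ∃ i v, w = FreeMonoid.of i * v := by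
    intro w
    cases w using FreeMonoid.casesOn with
    | one => exact Or.inl rfl
    | of_mul i v => exact Or.inr ⟨i, v, rfl⟩
  induction h with
  | of w w' h =>
    obtain ⟨i, j, v, v', rfl, rfl, hr⟩ := headRel_of_rel h
    refine ⟨by simp [hne], fun i' j' u u' h₁ h₂ _ => ?_⟩
    obtain ⟨rfl, rfl⟩ := of_mul_injective h₁
    obtain ⟨rfl, rfl⟩ := of_mul_injective h₂
    exact hr
  | refl w =>
    refine ⟨Iff.rfl, fun i j v v' h₁ h₂ _ => ?_⟩
    obtain ⟨rfl, rfl⟩ := of_mul_injective (h₁.symm.trans h₂)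
    exact headRel_self.2 rfl
  | @symm w w' h ih =>
    refine ⟨ih.1.symm, fun i j v v' h₁ h₂ hl => (ih.2 j i v' v h₂ h₁ ?_).symm⟩
    have hw : PresentedMonoid.mk (Rel n) w = PresentedMonoid.mk (Rel n) w' :=
      PresentedMonoid.mk_eq_mk_iff.2 h
    have hlen := congrArg len hw
    rw [h₁, h₂, map_mul, map_mul, len_mul, len_mul, mk_of, mk_of, len_σ, len_σ] at hlen
    omega
  | @trans w w' w'' h h' ih ih' =>
    refine ⟨ih.1.trans ih'.1, fun i j v v' h₁ h₂ hl => ?_⟩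
    rcases hcases w' with rfl | ⟨k, u, rfl⟩
    · exact absurd (h₁ ▸ ih.1.2 rfl) (hne _ _)
    · have hw : PresentedMonoid.mk (Rel n) w = PresentedMonoid.mk (Rel n) (FreeMonoid.of k * u) :=
        PresentedMonoid.mk_eq_mk_iff.2 h
      have hlen := congrArg len hw
      rw [h₁, map_mul, map_mul, len_mul, len_mul, mk_of, mk_of, len_σ, len_σ] at hlen
      exact HeadRel.trans H (by omega) (ih.2 i k v u h₁ rfl hl)
        (ih'.2 k j u v' rfl h₂ (by omega))
  | @mul w w' x x' h h' ih ih' =>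
    rcases hcases w with rfl | ⟨i, v, rfl⟩
    · obtain rfl := ih.1.1 rfl
      simpa using ih'
    · rcases hcases w' with rfl | ⟨j, v', rfl⟩
      · exact absurd (ih.1.2 rfl) (hne _ _)
      · refine ⟨by simp [mul_assoc, hne], fun i' j' u u' h₁ h₂ hl => ?_⟩
        rw [mul_assoc] at h₁ h₂
        obtain ⟨rfl, rfl⟩ := of_mul_injective h₁
        obtain ⟨rfl, rfl⟩ := of_mul_injective h₂
        rw [map_mul, len_mul] at hl
        obtain ⟨c, hc, hc'⟩ := ih.2 i j v v' rfl rfl (by omega)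
        have hx : PresentedMonoid.mk (Rel n) x = PresentedMonoid.mk (Rel n) x' :=
          PresentedMonoid.mk_eq_mk_iff.2 h'
        exact ⟨c * PresentedMonoid.mk (Rel n) x, by rw [map_mul, hc, mul_assoc],
          by rw [map_mul, hc', ← hx, mul_assoc]⟩

lemma keyBelow (L : ℕ) : KeyBelow n L := by
  induction L with
  | zero => intro i j a b h; omega
  | succ L ih =>
    intro i j a b hl h
    induction a using PresentedMonoid.inductionOn with | _ v
    induction b using PresentedMonoid.inductionOn with | _ v'
    rw [← mk_of, ← mk_of, ← map_mul, ← map_mul] at h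
    exact (key_of_conGen ih (PresentedMonoid.mk_eq_mk_iff.1 h)).2 i j v v' rfl rfl (by omega)

/-- Garside's key lemma: a common right multiple of two generators is a right multiple of their
lcm. -/
theorem headRel_of_eq {i j : Fin (n - 1)} {a b : BraidMonoid n} (h : σ n i * a = σ n j * b) :
    HeadRel i j a b :=
  keyBelow (len a + 1) i j a b (Nat.lt_succ_self _) h

lemma σ_mul_left_cancel {i : Fin (n - 1)} {a b : BraidMonoid n} (h : σ n i * a = σ n i * b) :
    a = b :=
  headRel_self.1 (headRel_of_eq h)

/-- Positive braid monoids are left cancellative. -/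
theorem mul_left_cancel_braid {x a b : BraidMonoid n} (h : x * a = x * b) : a = b := by
  induction x using braid_induction with
  | one => simpa using h
  | mul i y ih =>
    rw [mul_assoc, mul_assoc] at h
    exact ih (σ_mul_left_cancel h)

lemma mul_dvd_mul_left_iff_braid {x a b : BraidMonoid n} : x * a ∣ x * b ↔ a ∣ b := by
  refine ⟨fun ⟨c, hc⟩ => ⟨c, ?_⟩, mul_dvd_mul_left x⟩
  rw [mul_assoc] at hc
  exact mul_left_cancel_braid hc

lemma σ_mul_compl_dvd {i j : Fin (n - 1)} {z : BraidMonoid n} (hi : σ n i ∣ z) (hj : σ n j ∣ z) :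
    σ n i * compl i j ∣ z := by
  obtain ⟨a, rfl⟩ := hi
  obtain ⟨b, hb⟩ := hj
  obtain ⟨c, rfl, -⟩ := headRel_of_eq hb
  exact ⟨c, by rw [mul_assoc]⟩

/-- Two positive braids with a common right multiple have a right lcm. -/
theorem exists_lcm {z a b : BraidMonoid n} (ha : a ∣ z) (hb : b ∣ z) :
    ∃ m, ∀ w, m ∣ w ↔ a ∣ w ∧ b ∣ w := by
  induction hl : len z using Nat.strong_induction_on generalizing z a b with | _ l ih
  subst hl
  rcases eq_one_or_σ_mul a with rfl | ⟨i, a', rfl⟩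
  · exact ⟨b, fun w => by simp⟩
  rcases eq_one_or_σ_mul b with rfl | ⟨j, b', rfl⟩
  · exact ⟨σ n i * a', fun w => by simp⟩
  have hi : σ n i ∣ z := (dvd_mul_right _ _).trans ha
  have hj : σ n j ∣ z := (dvd_mul_right _ _).trans hb
  have hij := σ_mul_compl_dvd hi hj
  have hji := σ_mul_compl_dvd hj hi
  obtain ⟨zi, rfl⟩ := hi
  obtain ⟨zj, hzj⟩ := hj
  have hlen := congrArg len hzj
  simp only [len_mul, len_σ] at hlen ih
  -- `σ n i * p` is the lcm of `a` with the lcm of the two generators, and `σ n j * q` plays the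
  -- same part for `b`. Both begin with `σ n i`, so their lcm is found below `zi`.
  obtain ⟨p, hp⟩ := ih (len zi) (by omega) (mul_dvd_mul_left_iff_braid.1 ha)
    (mul_dvd_mul_left_iff_braid.1 hij) rfl
  rw [hzj] at hb hji
  obtain ⟨q, hq⟩ := ih (len zj) (by omega) (mul_dvd_mul_left_iff_braid.1 hb)
    (mul_dvd_mul_left_iff_braid.1 hji) rfl
  have hq' : σ n i ∣ σ n j * q := by
    refine (dvd_mul_right (σ n i) (compl i j)).trans ?_
    rw [σ_mul_compl]
    exact mul_dvd_mul_left _ ((hq q).1 dvd_rfl).2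
  have hqz : σ n j * q ∣ σ n i * zi := by
    rw [hzj]
    exact mul_dvd_mul_left _ ((hq zj).2 ⟨mul_dvd_mul_left_iff_braid.1 hb,
      mul_dvd_mul_left_iff_braid.1 hji⟩)
  obtain ⟨q', hqq⟩ := hq'
  rw [hqq] at hqz
  obtain ⟨r, hr⟩ := ih (len zi) (by omega) ((hp zi).2 ⟨mul_dvd_mul_left_iff_braid.1 ha,
    mul_dvd_mul_left_iff_braid.1 hij⟩) (mul_dvd_mul_left_iff_braid.1 hqz) rfl
  refine ⟨σ n i * r, fun w => ⟨fun h => ⟨?_, ?_⟩, fun ⟨h₁, h₂⟩ => ?_⟩⟩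
  · exact (mul_dvd_mul_left _ (((hp p).1 dvd_rfl).1.trans ((hr r).1 dvd_rfl).1)).trans h
  · refine (mul_dvd_mul_left _ ((hq q).1 dvd_rfl).1).trans ?_
    rw [hqq]
    exact (mul_dvd_mul_left _ ((hr r).1 dvd_rfl).2).trans h
  · have h₁' := σ_mul_compl_dvd ((dvd_mul_right _ _).trans h₁) ((dvd_mul_right _ _).trans h₂)
    have h₂' := h₁'
    rw [σ_mul_compl] at h₂'
    have hjw : σ n j * q ∣ w := by
      obtain ⟨w', rfl⟩ := (dvd_mul_right _ _).trans h₂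
      exact mul_dvd_mul_left _ ((hq w').2 ⟨mul_dvd_mul_left_iff_braid.1 h₂,
        mul_dvd_mul_left_iff_braid.1 h₂'⟩)
    rw [hqq] at hjw
    obtain ⟨w', rfl⟩ := (dvd_mul_right _ _).trans h₁
    rw [mul_dvd_mul_left_iff_braid] at *
    exact (hr w').2 ⟨(hp w').2 ⟨h₁, h₁'⟩, hjw⟩

end Garside

/-! ### Permutations: inversions, descents and simple braids -/

section Simple

variable {n : ℕ}

/-- The left strand position involved in the `k`-th generator. -/
def lo (k : Fin (n - 1)) : Fin n := ⟨k.val, by omega⟩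

/-- The right strand position involved in the `k`-th generator. -/
def hi (k : Fin (n - 1)) : Fin n := ⟨k.val + 1, by omega⟩

/-- The adjacent transposition `(k, k + 1)`. -/
def adjSwap (k : Fin (n - 1)) : Equiv.Perm (Fin n) := Equiv.swap (lo k) (hi k)

lemma lo_lt_hi (k : Fin (n - 1)) : lo k < hi k := Nat.lt_succ_self k.val

@[simp] lemma adjSwap_lo (k : Fin (n - 1)) : adjSwap k (lo k) = hi k := Equiv.swap_apply_left _ _

@[simp] lemma adjSwap_hi (k : Fin (n - 1)) : adjSwap k (hi k) = lo k := Equiv.swap_apply_right _ _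

lemma adjSwap_val (k : Fin (n - 1)) (x : Fin n) :
    (adjSwap k x).val =
      if x.val = k.val then k.val + 1 else if x.val = k.val + 1 then k.val else x.val := by
  unfold adjSwap
  rw [Equiv.swap_apply_def]
  simp only [lo, hi, Fin.ext_iff]
  split_ifs <;> rfl

@[simp] lemma adjSwap_mul_self (k : Fin (n - 1)) : adjSwap k * adjSwap k = 1 :=
  Equiv.swap_mul_self _ _

@[simp] lemma adjSwap_inv (k : Fin (n - 1)) : (adjSwap k)⁻¹ = adjSwap k := Equiv.swap_inv _ _

@[simp] lemma adjSwap_mul_cancel (k : Fin (n - 1)) (w : Equiv.Perm (Fin n)) :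
    adjSwap k * (adjSwap k * w) = w := by
  rw [← mul_assoc, adjSwap_mul_self, one_mul]

/-- The set of inversions of a permutation. -/
def invSet (w : Equiv.Perm (Fin n)) : Finset (Fin n × Fin n) :=
  Finset.univ.filter fun p => p.1 < p.2 ∧ w p.2 < w p.1

lemma mem_invSet {w : Equiv.Perm (Fin n)} {p : Fin n × Fin n} :
    p ∈ invSet w ↔ p.1 < p.2 ∧ w p.2 < w p.1 := by
  simp [invSet]

/-- The number of inversions of a permutation. -/
def inv (w : Equiv.Perm (Fin n)) : ℕ := (invSet w).card

/-- Right descents: `w k > w (k + 1)`. -/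
def RDesc (w : Equiv.Perm (Fin n)) (k : Fin (n - 1)) : Prop := w (hi k) < w (lo k)

lemma not_rdesc {w : Equiv.Perm (Fin n)} {k : Fin (n - 1)} :
    ¬ RDesc w k ↔ w (lo k) < w (hi k) := by
  have : w (lo k) ≠ w (hi k) := w.injective.ne (lo_lt_hi k).ne
  unfold RDesc
  rw [not_lt]
  exact ⟨fun h => lt_of_le_of_ne h this, le_of_lt⟩

lemma rdesc_mul_adjSwap {w : Equiv.Perm (Fin n)} {k : Fin (n - 1)} :
    RDesc (w * adjSwap k) k ↔ ¬ RDesc w k := by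
  rw [not_rdesc]; simp [RDesc]

@[simp] lemma inv_one : inv (1 : Equiv.Perm (Fin n)) = 0 := by
  simp only [inv, invSet, Finset.card_eq_zero, Finset.filter_eq_empty_iff]
  intro p _ h
  exact lt_asymm h.1 h.2

lemma inv_inv (w : Equiv.Perm (Fin n)) : inv w⁻¹ = inv w := by
  refine Finset.card_bij' (fun p _ => (w⁻¹ p.2, w⁻¹ p.1)) (fun p _ => (w p.2, w p.1)) ?_ ?_ ?_ ?_
  all_goals simp +contextual [invSet]

lemma adjSwap_lt_iff {k : Fin (n - 1)} {i j : Fin n} (h₁ : ¬ (i = lo k ∧ j = hi k))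
    (h₂ : ¬ (i = hi k ∧ j = lo k)) : adjSwap k i < adjSwap k j ↔ i < j := by
  rw [Fin.lt_def, Fin.lt_def, adjSwap_val, adjSwap_val]
  simp only [Fin.ext_iff, lo, hi] at h₁ h₂
  split_ifs <;> omega

/-- Swapping adjacent positions relabels the old inversions and adds only the swapped pair itself.
-/
lemma inv_mul_adjSwap {w : Equiv.Perm (Fin n)} {k : Fin (n - 1)} (h : ¬ RDesc w k) :
    inv (w * adjSwap k) = inv w + 1 := by
  rw [not_rdesc] at h
  have hset : invSet (w * adjSwap k) = insert (lo k, hi k)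
      ((invSet w).map ((adjSwap k).prodCongr (adjSwap k)).toEmbedding) := by
    ext ⟨i, j⟩
    simp only [Finset.mem_insert, Finset.mem_map_equiv, mem_invSet, Prod.mk.injEq, Equiv.Perm.mul_apply, Equiv.prodCongr_symm,
      Equiv.prodCongr_apply, Prod.map]
    have hs : (adjSwap k).symm = adjSwap k := adjSwap_inv k
    rw [hs]
    by_cases h₁ : i = lo k ∧ j = hi k
    · obtain ⟨rfl, rfl⟩ := h₁
      simp [lo_lt_hi, h]
    · by_cases h₂ : i = hi k ∧ j = lo k
      · obtain ⟨rfl, rfl⟩ := h₂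
        simp [h.le, (lo_lt_hi k).ne]
      · rw [adjSwap_lt_iff h₁ h₂]
        simp [h₁]
  unfold inv
  rw [hset, Finset.card_insert_of_notMem, Finset.card_map]
  have hs : (adjSwap k).symm = adjSwap k := adjSwap_inv k
  simp [Finset.mem_map_equiv, invSet, hs, (lo_lt_hi k).le]

lemma inv_mul_adjSwap_of_rdesc {w : Equiv.Perm (Fin n)} {k : Fin (n - 1)} (h : RDesc w k) :
    inv (w * adjSwap k) + 1 = inv w := by
  have h' : ¬ RDesc (w * adjSwap k) k := by rwa [rdesc_mul_adjSwap, not_not]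
  rw [← inv_mul_adjSwap h', mul_assoc, adjSwap_mul_self, mul_one]

lemma inv_adjSwap_mul {w : Equiv.Perm (Fin n)} {k : Fin (n - 1)} (h : ¬ RDesc w⁻¹ k) :
    inv (adjSwap k * w) = inv w + 1 := by
  rw [← inv_inv, mul_inv_rev, adjSwap_inv, inv_mul_adjSwap h, inv_inv]

lemma inv_adjSwap_mul_of_rdesc {w : Equiv.Perm (Fin n)} {k : Fin (n - 1)} (h : RDesc w⁻¹ k) :
    inv (adjSwap k * w) + 1 = inv w := by
  rw [← inv_inv (adjSwap k * w), mul_inv_rev, adjSwap_inv, inv_mul_adjSwap_of_rdesc h, inv_inv]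

lemma inv_mul_adjSwap_le (w : Equiv.Perm (Fin n)) (k : Fin (n - 1)) :
    inv (w * adjSwap k) ≤ inv w + 1 := by
  by_cases h : RDesc w k
  · have := inv_mul_adjSwap_of_rdesc h; omega
  · exact (inv_mul_adjSwap h).le

lemma inv_adjSwap_mul_le (w : Equiv.Perm (Fin n)) (k : Fin (n - 1)) :
    inv (adjSwap k * w) ≤ inv w + 1 := by
  by_cases h : RDesc w⁻¹ k
  · have := inv_adjSwap_mul_of_rdesc h; omega
  · exact (inv_adjSwap_mul h).le

lemma exists_rdesc {w : Equiv.Perm (Fin n)} (hw : w ≠ 1) : ∃ k, RDesc w k := by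
  by_contra! h
  apply hw
  cases n with
  | zero => exact Subsingleton.elim _ _
  | succ n =>
    have hmono : StrictMono w := Fin.strictMono_iff_lt_succ.2 fun i => not_rdesc.1 (h i)
    have := Subsingleton.elim (hmono.orderIsoOfSurjective _ w.surjective) (OrderIso.refl _)
    ext i
    exact congrArg Fin.val (congrArg (fun e : Fin (n + 1) ≃o Fin (n + 1) => e i) this)

/-- The permutation of a positive braid. -/
def perm (n : ℕ) : BraidMonoid n →* Equiv.Perm (Fin n) :=
  PresentedMonoid.lift adjSwap (by
    intro a b h
    cases h with
    | comm i j h =>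
      ext x
      simp only [map_mul, FreeMonoid.lift_eval_of, Equiv.Perm.mul_apply, adjSwap_val]
      split_ifs <;> omega
    | braid i j h =>
      have e : lo j = hi i := Fin.ext h.symm
      have h₁ : hi j ≠ hi i := by rw [← e]; exact (lo_lt_hi j).ne'
      have h₂ : hi j ≠ lo i := ((lo_lt_hi i).trans (e ▸ lo_lt_hi j)).ne'
      simp only [map_mul, FreeMonoid.lift_eval_of, adjSwap, e]
      rw [Equiv.swap_mul_swap_mul_swap (lo_lt_hi i).ne h₂.symm, Equiv.swap_comm (lo i),
        Equiv.swap_comm (hi i) (hi j), Equiv.swap_mul_swap_mul_swap h₁ h₂, Equiv.swap_comm])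

@[simp] lemma perm_σ (k : Fin (n - 1)) : perm n (σ n k) = adjSwap k := rfl

lemma inv_mul_perm_le (w : Equiv.Perm (Fin n)) (x : BraidMonoid n) :
    inv (w * perm n x) ≤ inv w + len x := by
  induction x using braid_induction generalizing w with
  | one => simp
  | mul i y ih =>
    have h₁ := ih (w * adjSwap i)
    have h₂ := inv_mul_adjSwap_le w i
    rw [map_mul, perm_σ, ← mul_assoc, len_mul, len_σ]
    omega

lemma inv_perm_mul_le (w : Equiv.Perm (Fin n)) (x : BraidMonoid n) :
    inv (perm n x * w) ≤ len x + inv w := by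
  induction x using braid_induction with
  | one => simp
  | mul i y ih =>
    have h₂ := inv_adjSwap_mul_le (perm n y * w) i
    rw [map_mul, perm_σ, mul_assoc, len_mul, len_σ]
    omega

lemma inv_perm_le (x : BraidMonoid n) : inv (perm n x) ≤ len x := by
  simpa using inv_perm_mul_le 1 x

/-- A positive braid is simple if its length is the number of inversions of its permutation. -/
def Simple (x : BraidMonoid n) : Prop := len x = inv (perm n x)

/-- Multiplying by a factor adds at most its length to the inversion number, so equality for the
product forces equality for each factor. -/
lemma Simple.of_mul {x y : BraidMonoid n} (h : Simple (x * y)) : Simple x ∧ Simple y := by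
  unfold Simple at *
  rw [map_mul, len_mul] at h
  have h₁ := inv_mul_perm_le (perm n x) y
  have h₂ := inv_perm_mul_le (perm n y) x
  have h₃ := inv_perm_le x
  have h₄ := inv_perm_le y
  omega

lemma Simple.of_dvd {x y : BraidMonoid n} (hy : Simple y) (h : x ∣ y) : Simple x := by
  obtain ⟨z, rfl⟩ := h
  exact hy.of_mul.1

lemma simple_one : Simple (1 : BraidMonoid n) := by simp [Simple]

lemma Simple.σ_mul {x : BraidMonoid n} (hx : Simple x) {k : Fin (n - 1)}
    (h : ¬ RDesc (perm n x)⁻¹ k) : Simple (σ n k * x) := by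
  unfold Simple at *
  rw [map_mul, perm_σ, inv_adjSwap_mul h, len_mul, len_σ, hx, add_comm]

lemma simple_mul_σ_iff {x : BraidMonoid n} (hx : Simple x) {k : Fin (n - 1)} :
    Simple (x * σ n k) ↔ ¬ RDesc (perm n x) k := by
  unfold Simple at *
  rw [map_mul, perm_σ, len_mul, len_σ, hx]
  by_cases h : RDesc (perm n x) k
  · have := inv_mul_adjSwap_of_rdesc h
    simp only [h, not_true, iff_false]
    omega
  · simp [h, inv_mul_adjSwap h]

lemma Simple.rdesc_of_σ_mul {k : Fin (n - 1)} {y : BraidMonoid n} (h : Simple (σ n k * y)) :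
    RDesc (perm n (σ n k * y))⁻¹ k := by
  by_contra hd
  have h₁ := inv_adjSwap_mul hd
  have h₂ := h.of_mul.2
  unfold Simple at *
  rw [map_mul, perm_σ] at *
  rw [adjSwap_mul_cancel] at h₁
  rw [len_mul, len_σ] at h
  omega

/-- Removing a left descent lowers the inversion number, so a reduced word is built by induction. -/
theorem exists_simple_lift (w : Equiv.Perm (Fin n)) : ∃ x, Simple x ∧ perm n x = w := by
  induction hl : inv w using Nat.strong_induction_on generalizing w with | _ l ih
  by_cases hw : w = 1
  · exact ⟨1, simple_one, by simp [hw]⟩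
  · obtain ⟨k, hk⟩ := exists_rdesc (w := w⁻¹) (by simpa using hw)
    have h := inv_adjSwap_mul_of_rdesc hk
    obtain ⟨x, hx, hxw⟩ := ih _ (by omega) (adjSwap k * w) rfl
    refine ⟨σ n k * x, hx.σ_mul ?_, by simp [hxw]⟩
    rwa [hxw, mul_inv_rev, adjSwap_inv, rdesc_mul_adjSwap, not_not]

/-- A permutation with two left descents `i` and `j` is reduced by the longest element of the
parabolic subgroup generated by the corresponding transpositions. -/
lemma inv_lcm_inv_mul {w : Equiv.Perm (Fin n)} {i j : Fin (n - 1)} (hij : i ≠ j)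
    (hi' : RDesc w⁻¹ i) (hj' : RDesc w⁻¹ j) :
    inv ((perm n (σ n i * compl i j))⁻¹ * w) + len (σ n i * compl i j) = inv w := by
  have hcond : ∀ (v : Equiv.Perm (Fin n)) (k : Fin (n - 1)), RDesc v⁻¹ k →
      inv (adjSwap k * v) + 1 = inv v := fun v k h => inv_adjSwap_mul_of_rdesc h
  rcases eq_or_far_or_adj i j with h | h | h
  · exact absurd h hij
  · have h₁ := hcond w i hi'
    have h₂ := hcond (adjSwap i * w) j (by
      have e₁ : adjSwap i (lo j) = lo j := by
        ext; rw [adjSwap_val]; unfold Far lo at *; dsimp only; split_ifs <;> omega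
      have e₂ : adjSwap i (hi j) = hi j := by
        ext; rw [adjSwap_val]; unfold Far hi at *; dsimp only; split_ifs <;> omega
      simpa [RDesc, e₁, e₂] using hj')
    rw [compl_far h]
    simp only [map_mul, perm_σ, mul_inv_rev, adjSwap_inv, len_mul, len_σ, mul_assoc]
    omega
  · have h₁ := hcond w i hi'
    have h₂ : inv (adjSwap j * (adjSwap i * w)) + 1 = inv (adjSwap i * w) ∧
        inv (adjSwap i * (adjSwap j * (adjSwap i * w))) + 1 =
          inv (adjSwap j * (adjSwap i * w)) := by
      -- `w⁻¹` decreases along the three consecutive positions of `i` and `j`, so each of the three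
      -- transpositions removes an inversion.
      rcases h with h | h
      · have e : lo j = hi i := Fin.ext h.symm
        have e₁ : adjSwap i (hi j) = hi j := by
          ext; rw [adjSwap_val]; unfold hi; dsimp only; split_ifs <;> omega
        have e₂ : adjSwap j (lo i) = lo i := by
          ext; rw [adjSwap_val]; unfold lo; dsimp only; split_ifs <;> omega
        have e₃ : adjSwap j (hi i) = hi j := by rw [← e, adjSwap_lo]
        unfold RDesc at hi' hj'
        rw [e] at hj'
        refine ⟨hcond _ _ ?_, hcond _ _ ?_⟩
        · simpa [RDesc, e, e₁] using hj'.trans hi'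
        · simpa [RDesc, e₁, e₂, e₃] using hj'
      · have e : lo i = hi j := Fin.ext h.symm
        have e₁ : adjSwap i (lo j) = lo j := by
          ext; rw [adjSwap_val]; unfold lo; dsimp only; split_ifs <;> omega
        have e₂ : adjSwap j (hi i) = hi i := by
          ext; rw [adjSwap_val]; unfold hi; dsimp only; split_ifs <;> omega
        have e₃ : adjSwap i (hi j) = hi i := by rw [← e, adjSwap_lo]
        unfold RDesc at hi' hj'
        rw [e] at hi'
        refine ⟨hcond _ _ ?_, hcond _ _ ?_⟩
        · simpa [RDesc, e₁, e₃] using hi'.trans hj'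
        · simpa [RDesc, e₁, e₂, e] using hj'
    rw [compl_adj h]
    simp only [map_mul, perm_σ, mul_inv_rev, adjSwap_inv, len_mul, len_σ, mul_assoc]
    omega

/-- A simple braid is determined by its permutation. -/
theorem Simple.eq_of_perm_eq {x y : BraidMonoid n} (hx : Simple x) (hy : Simple y)
    (h : perm n x = perm n y) : x = y := by
  induction hl : len x using Nat.strong_induction_on generalizing x y with | _ l ih
  subst hl
  have hlen : len y = len x := by rw [hx, hy, h]
  rcases eq_one_or_σ_mul x with rfl | ⟨i, a, rfl⟩
  · exact (len_eq_zero (by simpa using hlen)).symm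
  rcases eq_one_or_σ_mul y with rfl | ⟨j, b, rfl⟩
  · simp only [len_one, len_mul, len_σ] at hlen
    omega
  have ha := hx.of_mul.2
  have hb := hy.of_mul.2
  simp only [len_mul, len_σ] at ih hlen
  by_cases hij : i = j
  · subst hij
    rw [ih (len a) (by omega) ha hb (by simpa using h) rfl]
  have hi' := hx.rdesc_of_σ_mul
  have hj' := hy.rdesc_of_σ_mul
  rw [← h] at hj'
  have hinv := inv_lcm_inv_mul hij hi' hj'
  -- The lcm of the two first letters, completed by `z`, is simple with the common permutation.
  -- Written with first letter `i` it equals `x` by induction on the tail; written with first letter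
  -- `j` it equals `y`.
  obtain ⟨z, hz, hzw⟩ := exists_simple_lift
    ((perm n (σ n i * compl i j))⁻¹ * perm n (σ n i * a))
  have hpz : perm n (σ n i * compl i j * z) = perm n (σ n i * a) := by
    rw [map_mul, hzw, mul_inv_cancel_left]
  have hs : Simple (σ n i * compl i j * z) := by
    unfold Simple at hz ⊢
    rw [hpz, ← hinv, len_mul, hz, hzw, add_comm]
  have hs' := hs
  have hpz' := hpz
  rw [σ_mul_compl, mul_assoc] at hs' hpz'
  rw [mul_assoc] at hs hpz
  rw [h] at hpz'
  have e₁ := ih (len a) (by omega) ha hs.of_mul.2 (by simpa using hpz.symm) rfl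
  have e₂ := ih (len b) (by omega) hb hs'.of_mul.2 (by simpa using hpz'.symm) rfl
  rw [e₁, e₂, ← mul_assoc, ← mul_assoc, σ_mul_compl]

lemma Simple.σ_dvd_iff {x : BraidMonoid n} (hx : Simple x) {k : Fin (n - 1)} :
    σ n k ∣ x ↔ RDesc (perm n x)⁻¹ k := by
  constructor
  · rintro ⟨y, rfl⟩
    exact hx.rdesc_of_σ_mul
  · intro h
    obtain ⟨y, hy, hyw⟩ := exists_simple_lift (adjSwap k * perm n x)
    have hs : Simple (σ n k * y) := by
      apply hy.σ_mul
      rwa [hyw, mul_inv_rev, adjSwap_inv, rdesc_mul_adjSwap, not_not]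
    exact ⟨y, hx.eq_of_perm_eq hs (by simp [hyw])⟩

/-! ### The fundamental braid -/

/-- Composing with the reversal exchanges inversions and non-inversions, so the sum counts all
pairs. -/
lemma inv_rev_mul_add (w : Equiv.Perm (Fin n)) :
    inv (Fin.revPerm * w) + inv w = ∑ j ∈ Finset.range n, j := by
  have h : (invSet (Fin.revPerm * w)) =
      (Finset.univ.filter fun p : Fin n × Fin n => p.1 < p.2).filter fun p => ¬ w p.2 < w p.1 := by
    ext ⟨i, j⟩
    simp only [invSet, Finset.mem_filter, Finset.mem_univ, true_and, Equiv.Perm.mul_apply,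
      Fin.revPerm_apply, Fin.rev_lt_rev, not_lt]
    refine and_congr_right fun hij => ⟨le_of_lt, fun hle => lt_of_le_of_ne hle ?_⟩
    exact w.injective.ne hij.ne
  have h' : (invSet w) =
      (Finset.univ.filter fun p : Fin n × Fin n => p.1 < p.2).filter fun p => w p.2 < w p.1 := by
    rw [invSet, Finset.filter_filter]
  rw [inv, inv, h, h', add_comm, Finset.card_filter_add_card_filter_not, Finset.card_filter,
    Fintype.sum_prod_type_right, ← Fin.sum_univ_eq_sum_range (fun j => j) n]
  refine Finset.sum_congr rfl fun j _ => ?_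
  rw [← Finset.card_filter]
  simp [Finset.filter_gt_eq_Iio]

lemma inv_rev : inv (Fin.revPerm : Equiv.Perm (Fin n)) = ∑ j ∈ Finset.range n, j := by
  simpa using inv_rev_mul_add (1 : Equiv.Perm (Fin n))

/-- In permutations of `ℕ` the letters no longer depend on `n`, so the recursion of `deltaWord` can
be evaluated. -/
lemma perm_list_val (l : List (Fin (n - 1))) (j : Fin n) :
    (perm n (l.map (σ n)).prod j).val =
      ((l.map Fin.val).map fun k => Equiv.swap k (k + 1)).prod j.val := by
  induction l generalizing j with
  | nil => simp
  | cons k l ih =>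
    simp only [List.map_cons, List.prod_cons, map_mul, perm_σ, Equiv.Perm.mul_apply, ← ih,
      adjSwap_val, Equiv.swap_apply_def]

lemma prod_range_swap (m j : ℕ) :
    ((List.range m).map fun k => Equiv.swap k (k + 1)).prod j =
      if j < m then j + 1 else if j = m then 0 else j := by
  induction m generalizing j with
  | zero => simp
  | succ m ih =>
    rw [List.range_succ, List.map_append, List.prod_append, Equiv.Perm.mul_apply]
    simp only [List.map_cons, List.map_nil, List.prod_singleton, Equiv.swap_apply_def]
    split_ifs <;> rw [ih] <;> split_ifs <;> omega

lemma deltaWord_val (n : ℕ) : (deltaWord (n + 2)).map Fin.val =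
    List.range (n + 1) ++ (deltaWord (n + 1)).map Fin.val := by
  simp [deltaWord, Function.comp_def]

lemma prod_deltaWord_swap (n j : ℕ) :
    (((deltaWord n).map Fin.val).map fun k => Equiv.swap k (k + 1)).prod j =
      if j < n then n - 1 - j else j := by
  induction n generalizing j with
  | zero => simp [deltaWord]
  | succ n ih =>
    cases n with
    | zero => simp [deltaWord]
    | succ n =>
      rw [deltaWord_val, List.map_append, List.prod_append, Equiv.Perm.mul_apply, ih,
        prod_range_swap]
      split_ifs <;> omega

lemma perm_Δ : perm n (Δ n) = Fin.revPerm := by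
  ext j
  rw [Δ, perm_list_val, prod_deltaWord_swap, if_pos j.isLt, Fin.revPerm_apply, Fin.val_rev]
  omega

lemma len_list (l : List (Fin (n - 1))) : len (l.map (σ n)).prod = l.length := by
  induction l with
  | nil => simp
  | cons k l ih => simp [ih, add_comm]

lemma length_deltaWord (n : ℕ) : (deltaWord n).length = ∑ j ∈ Finset.range n, j := by
  induction n with
  | zero => rfl
  | succ n ih =>
    cases n with
    | zero => rfl
    | succ n => rw [Finset.sum_range_succ, ← ih]; simp [deltaWord, add_comm]

lemma simple_Δ : Simple (Δ n) := by
  rw [Simple, perm_Δ, inv_rev, ← length_deltaWord, Δ, len_list]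

lemma eq_Δ {x : BraidMonoid n} (h : len x = ∑ j ∈ Finset.range n, j)
    (hp : perm n x = Fin.revPerm) : x = Δ n :=
  Simple.eq_of_perm_eq (by rw [Simple, h, hp, inv_rev]) simple_Δ (by rw [hp, perm_Δ])

lemma Simple.exists_mul_eq_Δ {x : BraidMonoid n} (hx : Simple x) :
    ∃ y, Simple y ∧ x * y = Δ n := by
  obtain ⟨y, hy, hyw⟩ := exists_simple_lift ((perm n x)⁻¹ * Fin.revPerm)
  refine ⟨y, hy, eq_Δ ?_ (by simp [hyw])⟩
  have hr : (Fin.revPerm : Equiv.Perm (Fin n))⁻¹ = Fin.revPerm := Fin.revPerm_symm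
  have h := inv_rev_mul_add (perm n x)
  unfold Simple at hx hy
  rw [len_mul, hx, hy, hyw, ← inv_inv (_ * _), mul_inv_rev, _root_.inv_inv, hr, ← h, add_comm]

lemma simple_iff_dvd_Δ {x : BraidMonoid n} : Simple x ↔ x ∣ Δ n := by
  refine ⟨fun h => ?_, fun h => simple_Δ.of_dvd h⟩
  obtain ⟨y, -, hy⟩ := h.exists_mul_eq_Δ
  exact ⟨y, hy.symm⟩

end Simple

/-! ### Divisors of the square of the fundamental braid -/

section DivisorsSq

variable {n : ℕ}

lemma adjSwap_mul_rev (i : Fin (n - 1)) :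
    adjSwap i * Fin.revPerm = Fin.revPerm * adjSwap i.rev := by
  ext x
  simp only [Equiv.Perm.mul_apply, adjSwap_val, Fin.revPerm_apply, Fin.val_rev]
  split_ifs <;> omega

/-- If `Δ n = σ n i * y`, then `y * σ n i.rev` has the length and permutation of `Δ n`, hence equals
it. -/
lemma σ_mul_Δ (i : Fin (n - 1)) : σ n i * Δ n = Δ n * σ n i.rev := by
  have hd : σ n i ∣ Δ n := by
    rw [simple_Δ.σ_dvd_iff, perm_Δ]
    have hr : (Fin.revPerm : Equiv.Perm (Fin n))⁻¹ = Fin.revPerm := Fin.revPerm_symm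
    rw [hr, RDesc, Fin.revPerm_apply, Fin.revPerm_apply, Fin.rev_lt_rev]
    exact lo_lt_hi i
  obtain ⟨y, hy⟩ := hd
  have hlen : len (σ n i * y) = ∑ j ∈ Finset.range n, j := by
    rw [← hy, simple_Δ, perm_Δ, inv_rev]
  have hperm : perm n (σ n i * y) = Fin.revPerm := by rw [← hy, perm_Δ]
  have hy' : y * σ n i.rev = Δ n := by
    apply eq_Δ
    · rw [← hlen]; simp [add_comm]
    · rw [map_mul, perm_σ] at hperm ⊢
      apply mul_left_cancel (a := adjSwap i)
      rw [← mul_assoc, hperm, adjSwap_mul_rev]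
  nth_rewrite 1 [← hy']
  rw [← mul_assoc, ← hy]

lemma Δ_dvd_mul_Δ (x : BraidMonoid n) : Δ n ∣ x * Δ n := by
  induction x using braid_induction with
  | one => simp
  | mul i y ih =>
    obtain ⟨z, hz⟩ := ih
    exact ⟨σ n i.rev * z, by rw [mul_assoc, hz, ← mul_assoc, σ_mul_Δ, mul_assoc]⟩

lemma mul_Δ_sq (x : BraidMonoid n) : x * (Δ n * Δ n) = Δ n * Δ n * x := by
  induction x using braid_induction with
  | one => simp
  | mul i y ih =>
    rw [mul_assoc, ih, ← mul_assoc, ← mul_assoc (σ n i), σ_mul_Δ, mul_assoc (Δ n) (σ n _),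
      σ_mul_Δ, Fin.rev_rev, ← mul_assoc, mul_assoc _ _ y]

/-- Products of two simple braids. -/
def IsProd (x : BraidMonoid n) : Prop := ∃ a b, Simple a ∧ Simple b ∧ x = a * b

lemma exists_simple_lcm {z a b : BraidMonoid n} (hsa : Simple a) (hsb : Simple b) (ha : a ∣ z)
    (hb : b ∣ z) : ∃ m, Simple m ∧ a ∣ m ∧ b ∣ m ∧ m ∣ z := by
  obtain ⟨m, hm⟩ := exists_lcm ha hb
  exact ⟨m, simple_iff_dvd_Δ.2 ((hm _).2 ⟨simple_iff_dvd_Δ.1 hsa, simple_iff_dvd_Δ.1 hsb⟩),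
    ((hm m).1 dvd_rfl).1, ((hm m).1 dvd_rfl).2, (hm z).2 ⟨ha, hb⟩⟩

lemma simple_σ (k : Fin (n - 1)) : Simple (σ n k) := by
  have := simple_one.σ_mul (k := k) (n := n) (by simp [RDesc, (lo_lt_hi k).le])
  simpa using this

/-- The lcm of `σ n i` and `a` is `σ n i * a' = a * c` with `b = c * b'`; cancelling leaves `y = a'
* b'`. -/
lemma IsProd.of_σ_mul {i : Fin (n - 1)} {y : BraidMonoid n} (h : IsProd (σ n i * y)) :
    IsProd y := by
  obtain ⟨a, b, ha, hb, hab⟩ := h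
  obtain ⟨m, hm, ⟨a', rfl⟩, ⟨c, hc⟩, hmz⟩ := exists_simple_lcm (simple_σ i) ha
    (dvd_mul_right (σ n i) y) (hab ▸ dvd_mul_right a b)
  have hcb : c ∣ b := by
    rw [hc, hab] at hmz
    exact mul_dvd_mul_left_iff_braid.1 hmz
  obtain ⟨b', rfl⟩ := hcb
  refine ⟨a', b', hm.of_mul.2, hb.of_mul.2, ?_⟩
  rw [← mul_assoc, ← hc, mul_assoc] at hab
  exact σ_mul_left_cancel hab

lemma IsProd.of_mul {x y : BraidMonoid n} (h : IsProd (x * y)) : IsProd y := by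
  induction x using braid_induction with
  | one => simpa using h
  | mul i z ih =>
    rw [mul_assoc] at h
    exact ih h.of_σ_mul

theorem dvd_Δ_sq_iff {x : BraidMonoid n} : x ∣ Δ n ^ 2 ↔ IsProd x := by
  rw [sq]
  constructor
  · rintro ⟨y, hy⟩
    -- Centrality of the square turns a left divisor into a right divisor, to which `IsProd.of_mul`
    -- applies.
    have hyx : y * x = Δ n * Δ n := by
      apply mul_left_cancel_braid (x := x)
      rw [← mul_assoc, ← hy, mul_Δ_sq]
    exact IsProd.of_mul ⟨Δ n, Δ n, simple_Δ, simple_Δ, hyx⟩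
  · rintro ⟨a, b, ha, hb, rfl⟩
    obtain ⟨a', -, ha'⟩ := ha.exists_mul_eq_Δ
    have h₁ : a * b ∣ a * Δ n := mul_dvd_mul_left a (simple_iff_dvd_Δ.1 hb)
    refine h₁.trans ?_
    nth_rewrite 2 [← ha']
    rw [mul_assoc]
    exact mul_dvd_mul_left a (Δ_dvd_mul_Δ a')

/-- The greedy normal form: every left descent of `b` is a right descent of `a`. -/
structure Normal (a b : BraidMonoid n) : Prop where
  left : Simple a
  right : Simple b
  desc : ∀ k, RDesc (perm n b)⁻¹ k → RDesc (perm n a) k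

/-- A left descent of `b` that is not a right descent of `a` can be moved over to `a`; both factors
stay simple and `b` gets shorter. -/
lemma exists_normal {a b : BraidMonoid n} (ha : Simple a) (hb : Simple b) :
    ∃ a' b', Normal a' b' ∧ a * b = a' * b' := by
  induction hl : len b generalizing a b with
  | zero =>
    refine ⟨a, b, ⟨ha, hb, fun k hk => ?_⟩, rfl⟩
    rw [len_eq_zero hl] at hk
    simp only [map_one, _root_.inv_one, RDesc, Equiv.Perm.one_apply] at hk
    exact absurd hk (lo_lt_hi k).not_gt
  | succ l ih =>
    by_cases h : ∀ k, RDesc (perm n b)⁻¹ k → RDesc (perm n a) k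
    · exact ⟨a, b, ⟨ha, hb, h⟩, rfl⟩
    · push Not at h
      obtain ⟨k, hk, hk'⟩ := h
      obtain ⟨b', rfl⟩ := hb.σ_dvd_iff.2 hk
      simp only [len_mul, len_σ] at hl
      obtain ⟨p, q, hpq, h⟩ := ih ((simple_mul_σ_iff ha).2 hk') hb.of_mul.2 (by omega)
      exact ⟨p, q, hpq, by rw [← h, mul_assoc]⟩

/-- `a` is the greatest simple left divisor: if the lcm of `t` and `a` were longer than `a`, it
would begin with `a * σ n k` for a left descent `k` of `b`, which normality makes non-simple. -/
lemma Normal.dvd_left {a b t : BraidMonoid n} (h : Normal a b) (ht : Simple t)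
    (htd : t ∣ a * b) : t ∣ a := by
  obtain ⟨m, hm, htm, ⟨c, rfl⟩, hmz⟩ := exists_simple_lcm ht h.left htd (dvd_mul_right a b)
  rw [mul_dvd_mul_left_iff_braid] at hmz
  rcases eq_one_or_σ_mul c with rfl | ⟨k, c', rfl⟩
  · simpa using htm
  · have hk := h.desc k (h.right.σ_dvd_iff.1 ((dvd_mul_right _ _).trans hmz))
    rw [← mul_assoc] at hm
    exact absurd hk ((simple_mul_σ_iff h.left).1 hm.of_mul.1)

theorem Normal.unique {a b a' b' : BraidMonoid n} (h : Normal a b) (h' : Normal a' b')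
    (he : a * b = a' * b') : a = a' ∧ b = b' := by
  have h₁ : a ∣ a' := h'.dvd_left h.left (he ▸ dvd_mul_right a b)
  have h₂ : a' ∣ a := h.dvd_left h'.left (he ▸ dvd_mul_right a' b')
  obtain ⟨c, rfl⟩ := h₁
  have hlen : len (a * c) ≤ len a := by
    obtain ⟨d, hd⟩ := h₂
    rw [congrArg len hd, len_mul (a * c) d]
    omega
  have hc : c = 1 := len_eq_zero (by rw [len_mul] at hlen; omega)
  subst hc
  rw [mul_one] at he
  exact ⟨(mul_one a).symm, mul_left_cancel_braid he⟩

/-- The simple braid with a given permutation. -/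
noncomputable def simpleLift (w : Equiv.Perm (Fin n)) : BraidMonoid n :=
  (exists_simple_lift w).choose

lemma simple_simpleLift (w : Equiv.Perm (Fin n)) : Simple (simpleLift w) :=
  (exists_simple_lift w).choose_spec.1

@[simp] lemma perm_simpleLift (w : Equiv.Perm (Fin n)) : perm n (simpleLift w) = w :=
  (exists_simple_lift w).choose_spec.2

lemma Simple.simpleLift_perm {x : BraidMonoid n} (hx : Simple x) : simpleLift (perm n x) = x :=
  (simple_simpleLift _).eq_of_perm_eq hx (perm_simpleLift _)

lemma rdesc_rev_mul {f : Equiv.Perm (Fin n)} {k : Fin (n - 1)} :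
    RDesc (Fin.revPerm * f) k ↔ ¬ RDesc f k := by
  rw [not_rdesc]; simp [RDesc]

lemma isDescent_iff {f : Equiv.Perm (Fin n)} {i : ℕ} :
    IsDescent f i ↔ ∃ h : i < n - 1, RDesc f ⟨i, h⟩ := by
  unfold IsDescent RDesc lo hi
  exact ⟨fun ⟨h, h'⟩ => ⟨by omega, h'⟩, fun ⟨h, h'⟩ => ⟨by omega, h'⟩⟩

lemma not_common_descent_iff {f g : Equiv.Perm (Fin n)} :
    (¬ ∃ i : ℕ, IsDescent f i ∧ IsDescent g i) ↔ ∀ k, RDesc g k → ¬ RDesc f k := by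
  simp only [isDescent_iff]
  constructor
  · exact fun h k hg hf => h ⟨k.val, ⟨k.isLt, hf⟩, ⟨k.isLt, hg⟩⟩
  · rintro h ⟨i, ⟨hi, hf⟩, ⟨_, hg⟩⟩
    exact h ⟨i, hi⟩ hg hf

lemma normal_simpleLift {f g : Equiv.Perm (Fin n)}
    (h : ¬ ∃ i : ℕ, IsDescent f i ∧ IsDescent g i) :
    Normal (simpleLift (Fin.revPerm * f)) (simpleLift g⁻¹) := by
  refine ⟨simple_simpleLift _, simple_simpleLift _, fun k hk => ?_⟩
  rw [perm_simpleLift, rdesc_rev_mul]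
  rw [perm_simpleLift, _root_.inv_inv] at hk
  exact not_common_descent_iff.1 h k hk

/-- The divisors of `Δ ^ 2` correspond to the pairs of permutations without common descent. -/
theorem b_two_eq_ncard (n : ℕ) : b n 2 =
    {p : Equiv.Perm (Fin n) × Equiv.Perm (Fin n) |
      ¬ ∃ i : ℕ, IsDescent p.1 i ∧ IsDescent p.2 i}.ncard := by
  -- The reversal complements the descents of `p.1`, and inversion makes the descents of `p.2` left
  -- descents. Normality is then exactly the absence of a common descent.
  have himg : {x : BraidMonoid n | x ∣ Δ n ^ 2} =
      (fun p : Equiv.Perm (Fin n) × Equiv.Perm (Fin n) =>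
        simpleLift (Fin.revPerm * p.1) * simpleLift p.2⁻¹) ''
      {p | ¬ ∃ i : ℕ, IsDescent p.1 i ∧ IsDescent p.2 i} := by
    ext x
    simp only [Set.mem_ofPred_eq, dvd_Δ_sq_iff, Set.mem_image, Prod.exists]
    constructor
    · rintro ⟨a, b, ha, hb, rfl⟩
      obtain ⟨a', b', h, he⟩ := exists_normal ha hb
      have hr : (Fin.revPerm : Equiv.Perm (Fin n)) * Fin.revPerm = 1 := by ext; simp
      have hrr : Fin.revPerm * (Fin.revPerm * perm n a') = perm n a' := by
        rw [← mul_assoc, hr, one_mul]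
      refine ⟨Fin.revPerm * perm n a', (perm n b')⁻¹, ?_, ?_⟩
      · rw [not_common_descent_iff]
        intro k hk
        rw [rdesc_rev_mul, not_not]
        exact h.desc k hk
      · rw [hrr, _root_.inv_inv, h.left.simpleLift_perm, h.right.simpleLift_perm, he]
    · rintro ⟨f, g, -, rfl⟩
      exact ⟨_, _, simple_simpleLift _, simple_simpleLift _, rfl⟩
  rw [b, himg, Set.InjOn.ncard_image]
  rintro ⟨f, g⟩ h ⟨f', g'⟩ h' he
  obtain ⟨h₁, h₂⟩ := (normal_simpleLift h).unique (normal_simpleLift h') he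
  have e₁ := congrArg (perm n) h₁
  have e₂ := congrArg (perm n) h₂
  simp only [perm_simpleLift] at e₁ e₂
  exact Prod.ext (mul_left_cancel e₁) (inv_injective e₂)

end DivisorsSq

/-! ### Counting pairs of permutations without common descent -/

section Counting

/-- The pairs of permutations without common descent. -/
def noCommonDescent (n : ℕ) : Set (Equiv.Perm (Fin n) × Equiv.Perm (Fin n)) :=
  {p | ¬ ∃ i : ℕ, IsDescent p.1 i ∧ IsDescent p.2 i}

/-- The subsets of `Fin n` with `i` elements. -/
abbrev Subsets (n i : ℕ) : Type := {s : Finset (Fin n) // s.card = i}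

variable {i m : ℕ}

lemma Subsets.card_compl (s : Subsets (i + m) i) : (s.1ᶜ).card = m := by
  rw [Finset.card_compl, s.2, Fintype.card_fin]; omega

/-- The permutation of `i + m` whose first `i` values lie in `s`, in the order prescribed by `p`,
and whose last `m` values are decreasing. -/
def glue (s : Subsets (i + m) i) (p : Equiv.Perm (Fin i)) : Equiv.Perm (Fin (i + m)) :=
  finSumFinEquiv.symm.trans
    ((Equiv.sumCongr p Fin.revPerm).trans (finSumEquivOfFinset s.2 s.card_compl))

lemma glue_castAdd (s : Subsets (i + m) i) (p : Equiv.Perm (Fin i)) (j : Fin i) :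
    glue s p (Fin.castAdd m j) = s.1.orderEmbOfFin s.2 (p j) := by
  simp [glue]

lemma glue_natAdd (s : Subsets (i + m) i) (p : Equiv.Perm (Fin i)) (k : Fin m) :
    glue s p (Fin.natAdd i k) = s.1ᶜ.orderEmbOfFin s.card_compl k.rev := by
  simp [glue]

lemma isDescent_glue_iff (s : Subsets (i + m) i) (p : Equiv.Perm (Fin i)) {j : ℕ}
    (hj : j + 1 < i) : IsDescent (glue s p) j ↔ IsDescent p j := by
  have h₁ : (⟨j + 1, by omega⟩ : Fin (i + m)) = Fin.castAdd m ⟨j + 1, hj⟩ := rfl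
  have h₂ : (⟨j, by omega⟩ : Fin (i + m)) = Fin.castAdd m ⟨j, by omega⟩ := rfl
  constructor
  · rintro ⟨h, h'⟩
    rw [h₁, h₂, glue_castAdd, glue_castAdd, OrderEmbedding.lt_iff_lt] at h'
    exact ⟨hj, h'⟩
  · rintro ⟨h, h'⟩
    refine ⟨by omega, ?_⟩
    rw [h₁, h₂, glue_castAdd, glue_castAdd, OrderEmbedding.lt_iff_lt]
    exact h'

lemma isDescent_glue (s : Subsets (i + m) i) (p : Equiv.Perm (Fin i)) {j : ℕ}
    (hi : i ≤ j) (hj : j + 1 < i + m) : IsDescent (glue s p) j := by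
  refine ⟨hj, ?_⟩
  have h₁ : (⟨j + 1, hj⟩ : Fin (i + m)) = Fin.natAdd i ⟨j + 1 - i, by omega⟩ := by
    ext; simp; omega
  have h₂ : (⟨j, by omega⟩ : Fin (i + m)) = Fin.natAdd i ⟨j - i, by omega⟩ := by
    ext; simp; omega
  rw [h₁, h₂, glue_natAdd, glue_natAdd, OrderEmbedding.lt_iff_lt, Fin.rev_lt_rev, Fin.lt_def]
  dsimp only
  omega

lemma image_glue_castAdd (s : Subsets (i + m) i) (p : Equiv.Perm (Fin i)) :
    Finset.univ.image (fun j => glue s p (Fin.castAdd m j)) = s.1 := by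
  simp only [glue_castAdd]
  ext x
  have hx := Finset.range_orderEmbOfFin s.1 s.2
  rw [← Finset.mem_coe (s := s.1), ← hx]
  simp only [Finset.mem_image, Finset.mem_univ, true_and, Set.mem_range]
  exact (p.surjective.exists (p := fun y => s.1.orderEmbOfFin s.2 y = x)).symm

lemma glue_injective {s t : Subsets (i + m) i} {p q : Equiv.Perm (Fin i)}
    (h : glue s p = glue t q) : s = t ∧ p = q := by
  have hst : s = t := Subtype.ext (by rw [← image_glue_castAdd s p, h, image_glue_castAdd])
  subst hst
  refine ⟨rfl, Equiv.ext fun j => (s.1.orderEmbOfFin s.2).injective ?_⟩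
  rw [← glue_castAdd, ← glue_castAdd, h]

lemma exists_glue_eq (f : Equiv.Perm (Fin (i + m)))
    (hf : ∀ j, i ≤ j → j + 1 < i + m → IsDescent f j) : ∃ s p, glue s p = f := by
  have hinj : Function.Injective fun j : Fin i => f (Fin.castAdd m j) :=
    f.injective.comp (Fin.castAdd_injective i m)
  let s : Subsets (i + m) i := ⟨Finset.univ.image fun j : Fin i => f (Fin.castAdd m j), by
    rw [Finset.card_image_of_injective _ hinj, Finset.card_univ, Fintype.card_fin]⟩
  have hs : ∀ j, f (Fin.castAdd m j) ∈ s.1 := fun j =>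
    Finset.mem_image_of_mem _ (Finset.mem_univ j)
  let p₀ : Fin i → Fin i := fun j => (s.1.orderIsoOfFin s.2).symm ⟨f (Fin.castAdd m j), hs j⟩
  have hp₀ : Function.Injective p₀ := by
    intro j k hjk
    have := (s.1.orderIsoOfFin s.2).symm.injective hjk
    exact hinj (congrArg Subtype.val this)
  let p : Equiv.Perm (Fin i) := Equiv.ofBijective p₀ (Finite.injective_iff_bijective.1 hp₀)
  refine ⟨s, p, Equiv.ext fun x => ?_⟩
  -- Read backwards the tail increases, so it is the increasing enumeration of the complement of
  -- `s`.
  have htail : (fun k : Fin m => f (Fin.natAdd i k.rev)) =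
      s.1ᶜ.orderEmbOfFin s.card_compl := by
    refine Finset.orderEmbOfFin_unique _ (fun k => ?_) ?_
    · simp only [s, Finset.mem_compl, Finset.mem_image, Finset.mem_univ, true_and, not_exists]
      intro j hj
      have := congrArg Fin.val (f.injective hj)
      simp at this
      omega
    · have hanti : StrictAnti fun k : Fin m => f (Fin.natAdd i k) := by
        cases m with
        | zero => exact fun a => a.elim0
        | succ m =>
          refine Fin.strictAnti_iff_succ_lt.2 fun k => ?_
          obtain ⟨h, h'⟩ := hf (i + k.val) (by omega) (by omega)
          exact h'
      intro a b hab
      exact hanti (Fin.rev_lt_rev.2 hab)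
  induction x using Fin.addCases with
  | left j =>
    rw [glue_castAdd]
    have : s.1.orderIsoOfFin s.2 (p j) = ⟨f (Fin.castAdd m j), hs j⟩ :=
      (s.1.orderIsoOfFin s.2).apply_symm_apply _
    exact congrArg Subtype.val this
  | right k =>
    rw [glue_natAdd, ← htail]
    exact congrArg (fun k => f (Fin.natAdd i k)) k.rev_rev

/-- Pairs of permutations of `n` whose positions from `i` on are common descents, without common
descent inside the first `i` positions. -/
def freeAt (n i : ℕ) : Set (Equiv.Perm (Fin n) × Equiv.Perm (Fin n)) :=
  {p | (∀ j, j + 1 < i → ¬ (IsDescent p.1 j ∧ IsDescent p.2 j)) ∧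
    ∀ j, i ≤ j → j + 1 < n → IsDescent p.1 j ∧ IsDescent p.2 j}

/-- Pairs of permutations of `n` whose common descents are exactly the positions from `i` on. -/
def descFrom (n i : ℕ) : Set (Equiv.Perm (Fin n) × Equiv.Perm (Fin n)) :=
  {p | (∀ j, j < i → ¬ (IsDescent p.1 j ∧ IsDescent p.2 j)) ∧
    ∀ j, i ≤ j → j + 1 < n → IsDescent p.1 j ∧ IsDescent p.2 j}

/-- The value sets of the first `i` positions are chosen independently for the two permutations,
whence the square; common descents among these positions survive standardization. -/
lemma ncard_freeAt_add (i m : ℕ) : (freeAt (i + m) i).ncard =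
    (i + m).choose i ^ 2 * (noCommonDescent i).ncard := by
  have himg : freeAt (i + m) i =
      (fun x : (Subsets (i + m) i × Subsets (i + m) i) ×
        (Equiv.Perm (Fin i) × Equiv.Perm (Fin i)) => (glue x.1.1 x.2.1, glue x.1.2 x.2.2)) ''
      (Set.univ ×ˢ noCommonDescent i) := by
    ext ⟨f, g⟩
    constructor
    · rintro ⟨h₁, h₂⟩
      obtain ⟨s, p, rfl⟩ := exists_glue_eq f fun j hj hj' => (h₂ j hj hj').1
      obtain ⟨t, q, rfl⟩ := exists_glue_eq g fun j hj hj' => (h₂ j hj hj').2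
      refine ⟨((s, t), (p, q)), ⟨trivial, ?_⟩, rfl⟩
      rintro ⟨j, hp, hq⟩
      obtain ⟨hj, -⟩ := id hp
      exact h₁ j hj ⟨(isDescent_glue_iff s p hj).2 hp, (isDescent_glue_iff t q hj).2 hq⟩
    · rintro ⟨⟨⟨s, t⟩, ⟨p, q⟩⟩, ⟨-, h⟩, he⟩
      obtain ⟨rfl, rfl⟩ := Prod.mk.inj he
      refine ⟨fun j hj hd => h ⟨j, (isDescent_glue_iff s p hj).1 hd.1,
        (isDescent_glue_iff t q hj).1 hd.2⟩, fun j hj hj' => ⟨isDescent_glue s p hj hj',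
        isDescent_glue t q hj hj'⟩⟩
  rw [himg, Set.InjOn.ncard_image, Set.ncard_prod, Set.ncard_univ, Nat.card_prod,
    Nat.card_eq_fintype_card, Fintype.card_finset_len, Fintype.card_fin, sq]
  rintro ⟨⟨s, t⟩, ⟨p, q⟩⟩ - ⟨⟨s', t'⟩, ⟨p', q'⟩⟩ - he
  obtain ⟨h₁, h₂⟩ := Prod.mk.inj he
  obtain ⟨rfl, rfl⟩ := glue_injective h₁
  obtain ⟨rfl, rfl⟩ := glue_injective h₂
  rfl

lemma ncard_freeAt {n i : ℕ} (h : i ≤ n) : (freeAt n i).ncard =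
    n.choose i ^ 2 * (noCommonDescent i).ncard := by
  obtain ⟨m, rfl⟩ := Nat.exists_eq_add_of_le h
  exact ncard_freeAt_add i m

lemma freeAt_zero (n : ℕ) : freeAt n 0 = descFrom n 0 := by
  ext p; simp [freeAt, descFrom]

/-- Here the decreasing block is empty and there is no junction, so only one of the two classes of
`freeAt_succ` occurs. -/
lemma freeAt_self (n : ℕ) : freeAt (n + 1) (n + 1) = descFrom (n + 1) n := by
  ext p
  refine and_congr ?_ ?_
  · exact forall_congr' fun j => by rw [Nat.add_lt_add_iff_right]
  · exact ⟨fun _ j h h' => by omega, fun _ j h h' => by omega⟩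

/-- Position `i` is the only one left free; the two classes record whether it is a common descent.
-/
lemma freeAt_succ {n i : ℕ} (h : i + 1 < n) :
    freeAt n (i + 1) = descFrom n (i + 1) ∪ descFrom n i := by
  ext p
  constructor
  · rintro ⟨h₁, h₂⟩
    by_cases hd : IsDescent p.1 i ∧ IsDescent p.2 i
    · refine Or.inr ⟨fun j hj => h₁ j (by omega), fun j hj hj' => ?_⟩
      rcases hj.eq_or_lt with rfl | hlt
      · exact hd
      · exact h₂ j hlt hj'
    · refine Or.inl ⟨fun j hj => ?_, h₂⟩
      rcases (Nat.lt_succ_iff.1 hj).eq_or_lt with rfl | hlt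
      · exact hd
      · exact h₁ j (by omega)
  · rintro (⟨h₁, h₂⟩ | ⟨h₁, h₂⟩)
    · exact ⟨fun j hj => h₁ j (by omega), h₂⟩
    · exact ⟨fun j hj => h₁ j (by omega), fun j hj => h₂ j (by omega)⟩

lemma ncard_freeAt_succ {n i : ℕ} (h : i + 1 < n) :
    (freeAt n (i + 1)).ncard = (descFrom n (i + 1)).ncard + (descFrom n i).ncard := by
  rw [freeAt_succ h, Set.ncard_union_eq]
  rw [Set.disjoint_left]
  rintro p ⟨h₁, -⟩ ⟨-, h₂⟩
  exact h₁ i (Nat.lt_succ_self i) (h₂ i le_rfl h)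

lemma sum_ncard_freeAt (n k : ℕ) (hk : k ≤ n) :
    ∑ i ∈ Finset.range (k + 1), (-1 : ℤ) ^ i * ((freeAt (n + 1) i).ncard : ℤ) =
      (-1) ^ k * ((descFrom (n + 1) k).ncard : ℤ) := by
  induction k with
  | zero => simp [freeAt_zero]
  | succ k ih =>
    rw [Finset.sum_range_succ, ih (by omega), ncard_freeAt_succ (by omega)]
    push_cast
    ring

/-- The alternating sum identity of Carlitz, Scoville and Vaughan. -/
theorem sum_choose_sq_mul_ncard {n : ℕ} (hn : 1 ≤ n) :
    ∑ i ∈ Finset.range (n + 1),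
      (-1 : ℤ) ^ i * (n.choose i : ℤ) ^ 2 * ((noCommonDescent i).ncard : ℤ) = 0 := by
  obtain ⟨n, rfl⟩ := Nat.exists_eq_add_of_le' hn
  have h : ∑ i ∈ Finset.range (n + 1 + 1), (-1 : ℤ) ^ i * ((freeAt (n + 1) i).ncard : ℤ) = 0 := by
    rw [Finset.sum_range_succ, sum_ncard_freeAt n n le_rfl, freeAt_self]
    ring
  rw [← h]
  refine Finset.sum_congr rfl fun i hi => ?_
  rw [ncard_freeAt (Nat.lt_succ_iff.1 (Finset.mem_range.1 hi))]
  push_cast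
  ring

end Counting

/-! ### Generating function -/

section GeneratingFunction

lemma sum_choose_sq_mul_b {n : ℕ} (hn : 1 ≤ n) :
    ∑ i ∈ Finset.range (n + 1), (-1 : ℤ) ^ i * (n.choose i : ℤ) ^ 2 * (b i 2 : ℤ) = 0 := by
  simp only [b_two_eq_ncard]
  exact sum_choose_sq_mul_ncard hn

lemma b_zero_two : b 0 2 = 1 := by
  rw [b_two_eq_ncard, Set.ncard_eq_one]
  refine ⟨(1, 1), Set.eq_singleton_iff_unique_mem.2 ⟨?_, fun p _ => Subsingleton.elim _ _⟩⟩
  rintro ⟨i, ⟨h, -⟩, -⟩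
  omega

lemma b_two_rec {n : ℕ} (hn : 1 ≤ n) : (b n 2 : ℤ) =
    ∑ i ∈ Finset.range n, (-1 : ℤ) ^ (n + i + 1) * (n.choose i : ℤ) ^ 2 * (b i 2 : ℤ) := by
  have h := sum_choose_sq_mul_b hn
  rw [Finset.sum_range_succ, Nat.choose_self] at h
  have hsq : (-1 : ℤ) ^ n * (-1) ^ n = 1 := by rw [← mul_pow]; simp
  have hsum : ∑ i ∈ Finset.range n, (-1 : ℤ) ^ (n + i + 1) * (n.choose i : ℤ) ^ 2 * (b i 2 : ℤ) =
      -(-1) ^ n * ∑ i ∈ Finset.range n, (-1 : ℤ) ^ i * (n.choose i : ℤ) ^ 2 * (b i 2 : ℤ) := by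
    rw [Finset.mul_sum]
    exact Finset.sum_congr rfl fun i _ => by ring
  rw [hsum, eq_neg_of_add_eq_zero_left h]
  push_cast
  linear_combination (-(b n 2 : ℤ)) * hsq

lemma b_two_le (n : ℕ) : b n 2 ≤ n ! ^ 2 := by
  rw [b_two_eq_ncard]
  refine (Set.ncard_le_card _).trans ?_
  rw [Nat.card_prod, Nat.card_perm, Nat.card_fin, sq]

/-- Dividing the recursion by `n ! ^ 2` splits the squared binomial into a convolution. The field is
`ℚ` for the formal identity and `ℂ` for the analytic one. -/
lemma sum_antidiagonal_b {K : Type*} [Field K] [CharZero K] (n : ℕ) :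
    ∑ p ∈ Finset.HasAntidiagonal.antidiagonal n,
      (b p.1 2 : K) / (p.1 ! : K) ^ 2 * ((-1) ^ p.2 / (p.2 ! : K) ^ 2) =
      if n = 0 then 1 else 0 := by
  split_ifs with hn
  · subst hn; simp [b_zero_two]
  have h := congrArg (Int.cast : ℤ → K) (sum_choose_sq_mul_b (Nat.one_le_iff_ne_zero.2 hn))
  push_cast at h
  rw [Finset.Nat.sum_antidiagonal_eq_sum_range_succ_mk,
    ← mul_zero ((-1 : K) ^ n / (n ! : K) ^ 2), ← h, Finset.mul_sum]
  refine Finset.sum_congr rfl fun i hi => ?_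
  have hin : i ≤ n := Nat.lt_succ_iff.1 (Finset.mem_range.1 hi)
  have hpow : (-1 : K) ^ n * (-1) ^ i = (-1) ^ (n - i) := by
    obtain ⟨m, rfl⟩ := Nat.exists_eq_add_of_le hin
    rw [Nat.add_sub_cancel_left, pow_add, mul_right_comm, ← mul_pow]
    simp
  have h₁ : (n ! : K) ≠ 0 := Nat.cast_ne_zero.2 n.factorial_ne_zero
  have h₂ : (i ! : K) ≠ 0 := Nat.cast_ne_zero.2 i.factorial_ne_zero
  have h₃ : ((n - i)! : K) ≠ 0 := Nat.cast_ne_zero.2 (n - i).factorial_ne_zero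
  rw [Nat.cast_choose K hin, ← hpow]
  field_simp

lemma powerSeries_b : PowerSeries.mk (fun n : ℕ => (b n 2 : ℚ) / (n ! : ℚ) ^ 2) =
    (PowerSeries.mk (fun n : ℕ => (-1 : ℚ) ^ n / (n ! : ℚ) ^ 2))⁻¹ := by
  rw [PowerSeries.eq_inv_iff_mul_eq_one (by simp)]
  ext n
  rw [PowerSeries.coeff_mul, PowerSeries.coeff_one]
  simp only [PowerSeries.coeff_mk]
  exact sum_antidiagonal_b n

lemma summable_of_norm_le_pow {F : ℕ → ℂ} {x : ℂ} (hx : ‖x‖ < 1) (h : ∀ m, ‖F m‖ ≤ ‖x‖ ^ m) :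
    Summable fun m => ‖F m‖ :=
  Summable.of_nonneg_of_le (fun _ => norm_nonneg _) h
    (summable_geometric_of_lt_one (norm_nonneg x) hx)

lemma norm_mul_pow_div_le {c x : ℂ} {m : ℕ} (hc : ‖c‖ ≤ (m ! : ℝ) ^ 2) :
    ‖c * (x ^ m / (m ! : ℂ) ^ 2)‖ ≤ ‖x‖ ^ m := by
  have h : (0 : ℝ) < (m ! : ℝ) ^ 2 := by positivity
  rw [norm_mul, norm_div, norm_pow, norm_pow, Complex.norm_natCast, mul_div_assoc', div_le_iff₀ h,
    mul_comm]
  gcongr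

lemma besselJ0_two_mul (x s : ℂ) (hs : s ^ 2 = x) :
    besselJ0 (2 * s) = ∑' m : ℕ, (-1 : ℂ) ^ m * (x ^ m / (m ! : ℂ) ^ 2) := by
  refine tsum_congr fun m => ?_
  rw [mul_div_cancel_left₀ s two_ne_zero, pow_mul, hs]
  ring

theorem hasSum_b {x s : ℂ} (hx : ‖x‖ < 1) (hs : s ^ 2 = x) :
    besselJ0 (2 * s) ≠ 0 ∧
      HasSum (fun n : ℕ => (b n 2 : ℂ) * (x ^ n / (n ! : ℂ) ^ 2)) (1 / besselJ0 (2 * s)) := by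
  have hF : Summable fun m => ‖(b m 2 : ℂ) * (x ^ m / (m ! : ℂ) ^ 2)‖ := by
    refine summable_of_norm_le_pow hx fun m => norm_mul_pow_div_le ?_
    rw [Complex.norm_natCast]
    exact_mod_cast b_two_le m
  have hG : Summable fun m => ‖(-1 : ℂ) ^ m * (x ^ m / (m ! : ℂ) ^ 2)‖ := by
    refine summable_of_norm_le_pow hx fun m => norm_mul_pow_div_le ?_
    rw [norm_pow, norm_neg, norm_one, one_pow]
    exact one_le_pow₀ (by exact_mod_cast m.factorial_pos)
  -- The Cauchy product of the two absolutely convergent series is 1, which gives the nonvanishing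
  -- and the value at once.
  have hmul := tsum_mul_tsum_eq_tsum_sum_antidiagonal_of_summable_norm hF hG
  have hterm : ∀ n : ℕ, ∑ p ∈ Finset.HasAntidiagonal.antidiagonal n,
      (b p.1 2 : ℂ) * (x ^ p.1 / (p.1 ! : ℂ) ^ 2) * ((-1) ^ p.2 * (x ^ p.2 / (p.2 ! : ℂ) ^ 2)) =
      if n = 0 then 1 else 0 := by
    intro n
    have h := congrArg (x ^ n * ·) (sum_antidiagonal_b (K := ℂ) n)
    have hr : x ^ n * (if n = 0 then 1 else 0) = if n = 0 then 1 else 0 := by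
      split_ifs with hn <;> simp [hn]
    simp only [hr] at h
    rw [← h, Finset.mul_sum]
    refine Finset.sum_congr rfl fun p hp => ?_
    rw [← Finset.HasAntidiagonal.mem_antidiagonal.1 hp, pow_add]
    ring
  rw [tsum_congr hterm, tsum_ite_eq, ← besselJ0_two_mul x s hs] at hmul
  refine ⟨right_ne_zero_of_mul_eq_one hmul, ?_⟩
  rw [← eq_one_div_of_mul_eq_one_left hmul]
  exact hF.of_norm.hasSum

end GeneratingFunction

end PositiveBraid

theorem proposition4p2 :
    -- the induction
    PositiveBraid.b 0 2 = 1 ∧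
    (∀ n : ℕ, 1 ≤ n →
      (PositiveBraid.b n 2 : ℤ) =
        ∑ i ∈ Finset.range n,
          (-1 : ℤ) ^ (n + i + 1) * (n.choose i : ℤ) ^ 2 * (PositiveBraid.b i 2 : ℤ)) ∧
    -- the induction determines the sequence
    (∀ a : ℕ → ℤ, a 0 = 1 →
      (∀ n : ℕ, 1 ≤ n →
        a n = ∑ i ∈ Finset.range n, (-1 : ℤ) ^ (n + i + 1) * (n.choose i : ℤ) ^ 2 * a i) →
      ∀ n : ℕ, a n = (PositiveBraid.b n 2 : ℤ)) ∧
    -- the double exponential generating function, as a formal power series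
    (PowerSeries.mk (fun n : ℕ => (PositiveBraid.b n 2 : ℚ) / (n ! : ℚ) ^ 2) =
      (PowerSeries.mk (fun n : ℕ => (-1 : ℚ) ^ n / (n ! : ℚ) ^ 2))⁻¹) ∧
    -- its value `1 / J_0 (2 √x)`, where `s` is any square root of `x`
    (∀ x s : ℂ, ‖x‖ < 1 → s ^ 2 = x →
      PositiveBraid.besselJ0 (2 * s) ≠ 0 ∧
      HasSum (fun n : ℕ => (PositiveBraid.b n 2 : ℂ) * (x ^ n / (n ! : ℂ) ^ 2))
        (1 / PositiveBraid.besselJ0 (2 * s))) ∧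
    -- the interpretation as pairs of permutations without common descent
    (∀ n : ℕ, PositiveBraid.b n 2 =
      {p : Equiv.Perm (Fin n) × Equiv.Perm (Fin n) |
        ¬ ∃ i : ℕ, PositiveBraid.IsDescent p.1 i ∧ PositiveBraid.IsDescent p.2 i}.ncard) := by
  refine ⟨PositiveBraid.b_zero_two, fun n hn => PositiveBraid.b_two_rec hn, ?_,
    PositiveBraid.powerSeries_b, fun x s hx hs => PositiveBraid.hasSum_b hx hs,
    PositiveBraid.b_two_eq_ncard⟩
  intro a h₀ ha n
  induction n using Nat.strong_induction_on with | _ n ih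
  rcases Nat.eq_zero_or_pos n with rfl | hn
  · rw [h₀, PositiveBraid.b_zero_two, Nat.cast_one]
  · rw [ha n hn, PositiveBraid.b_two_rec hn]
    exact Finset.sum_congr rfl fun i hi => by rw [ih i (Finset.mem_range.1 hi)]
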